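/- Let $H$ be a complex Hilbert space, let $A\subset\mathcal B(H)$ be a von Neumann algebra, and let $\Omega\in H$ be a cyclic and separating vector for $A$ such that $\mu(a)=\langle\Omega,a\Omega\rangle$ is a trace on $A$, i.e. $\mu(ab)=\mu(ba)$ for all $a,b\in A$. Let $J:H\to H$ be the modular conjugation associated to $\mu$, i.e. the continuous conjugate-linear operator with $Ja\Omega=a^*\Omega$ for all $a\in A$, and put $j(a)=Ja^*J$ for $a\in\mathcal B(H)$. Let $F\subset A$ be a von Neumann subalgebra containing the unit of $A$, let $e_F$ be the orthogonal projection of $H$ onto $H_F=\overline{F\Omega}$, and let $\langle A,e_F\rangle$ be the basic construction, i.e. the smallest von Neumann algebra in $\mathcal B(H)$ containing $A$ and $e_F$. Let $V$ be a closed subspace of $H$, and let $P_V$ be the orthogonal projection of $H$ onto $V$. Then $V$ is a right-$F$-submodule of $H$, i.e. $xa:=j(a)x\in V$ for all $x\in V$ and all $a\in F$, if and only if $P_V\in\langle A,e_F\rangle$. -/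

import Mathlib

open scoped InnerProductSpace ComplexConjugate

namespace VonNeumannAlgebra

variable {H : Type*} [NormedAddCommGroup H] [InnerProductSpace ℂ H] [CompleteSpace H]

/-- The linear map `A → H`, `a ↦ a Ω`. -/
noncomputable def orbitMap (A : VonNeumannAlgebra H) (Ω : H) :
    A.toStarSubalgebra →ₗ[ℂ] H where
  toFun a := (a : H →L[ℂ] H) Ω
  map_add' a b := by simp
  map_smul' c a := by simp

/-- The conjugate linear map `A → H`, `a ↦ a* Ω`. -/
noncomputable def starOrbitMap (A : VonNeumannAlgebra H) (Ω : H) :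
    A.toStarSubalgebra →ₗ⋆[ℂ] H where
  toFun a := (star (a : H →L[ℂ] H)) Ω
  map_add' a b := by simp
  map_smul' c a := by simp

/-- The vector functional `μ(a) = ⟪Ω, a Ω⟫` on `A` (linear in the right argument). -/
noncomputable def vectorFunctional (A : VonNeumannAlgebra H) (Ω : H)
    (a : A.toStarSubalgebra) : ℂ :=
  ⟪Ω, (a : H →L[ℂ] H) Ω⟫_ℂ

/-- `Ω` is a cyclic and separating vector for `A`, and the vector functional
`μ(a) = ⟪Ω, a Ω⟫` is a trace on `A`. -/
structure IsTraceVector (A : VonNeumannAlgebra H) (Ω : H) : Prop where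
  cyclic : DenseRange (A.orbitMap Ω)
  separating : Function.Injective (A.orbitMap Ω)
  trace : ∀ a b : A.toStarSubalgebra,
    A.vectorFunctional Ω (a * b) = A.vectorFunctional Ω (b * a)

/-- The modular conjugation `J` associated to the trace given by `Ω`: the continuous conjugate
linear operator on `H` extending `a Ω ↦ a* Ω` (`a ∈ A`). -/
noncomputable def modularConj (A : VonNeumannAlgebra H) (Ω : H) : H →L⋆[ℂ] H :=
  (A.starOrbitMap Ω).extendOfNorm (A.orbitMap Ω)

theorem IsTraceVector.norm_starOrbitMap {A : VonNeumannAlgebra H} {Ω : H}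
    (h : A.IsTraceVector Ω) (a : A.toStarSubalgebra) :
    ‖A.starOrbitMap Ω a‖ = ‖A.orbitMap Ω a‖ := by
  have h1 := h.trace a (star a)
  simp only [vectorFunctional, MulMemClass.coe_mul, mul_apply_eq_comp,
    StarMemClass.coe_star] at h1
  have h2 : ⟪A.starOrbitMap Ω a, A.starOrbitMap Ω a⟫_ℂ = ⟪A.orbitMap Ω a, A.orbitMap Ω a⟫_ℂ := by
    simp only [starOrbitMap, orbitMap, LinearMap.coe_mk, AddHom.coe_mk]
    rw [ContinuousLinearMap.star_eq_adjoint] at h1 ⊢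
    rw [ContinuousLinearMap.adjoint_inner_left, h1, ContinuousLinearMap.adjoint_inner_right]
  rw [inner_self_eq_norm_sq_to_K, inner_self_eq_norm_sq_to_K] at h2
  have h3 : ‖A.starOrbitMap Ω a‖ ^ 2 = ‖A.orbitMap Ω a‖ ^ 2 := by exact_mod_cast h2
  exact (pow_left_inj₀ (norm_nonneg _) (norm_nonneg _) two_ne_zero).1 h3

/-- `J (a Ω) = a* Ω` for all `a ∈ A`. -/
theorem IsTraceVector.modularConj_apply {A : VonNeumannAlgebra H} {Ω : H}
    (h : A.IsTraceVector Ω) (a : A.toStarSubalgebra) :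
    A.modularConj Ω ((a : H →L[ℂ] H) Ω) = (star (a : H →L[ℂ] H)) Ω :=
  LinearMap.extendOfNorm_eq (f := A.starOrbitMap Ω) (e := A.orbitMap Ω) h.cyclic
    ⟨1, fun x => by rw [one_mul, h.norm_starOrbitMap]⟩ a

/-- The map `j : B(H) → B(H)`, `j(a) = J a* J`. -/
noncomputable def conjMap (A : VonNeumannAlgebra H) (Ω : H) (a : H →L[ℂ] H) : H →L[ℂ] H :=
  (A.modularConj Ω).comp ((star a).comp (A.modularConj Ω))

/-- The right action of `A` on `H`: `x a := j(a) x`. -/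
noncomputable def rightAct (A : VonNeumannAlgebra H) (Ω : H) (x : H) (a : H →L[ℂ] H) : H :=
  A.conjMap Ω a x

/-- A closed subspace `V` of `H` is a right-`F`-submodule (for `F` a von Neumann subalgebra
of `A`) if `x a ∈ V` for all `x ∈ V` and `a ∈ F`. -/
def IsRightSubmodule (A : VonNeumannAlgebra H) (Ω : H) (F : VonNeumannAlgebra H)
    (V : ClosedSubmodule ℂ H) : Prop :=
  ∀ x ∈ V, ∀ a ∈ F, A.rightAct Ω x a ∈ V

/-- The closed subspace `H_F`, the closure of `F Ω`. -/
noncomputable def cyclicSubspace (F : VonNeumannAlgebra H) (Ω : H) : ClosedSubmodule ℂ H :=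
  (LinearMap.range (F.orbitMap Ω)).closure

/-- The orthogonal projection `e_F` of `H` onto `H_F`. -/
noncomputable def cyclicProjection (F : VonNeumannAlgebra H) (Ω : H) : H →L[ℂ] H :=
  (F.cyclicSubspace Ω).toSubmodule.starProjection

/-- The von Neumann algebra generated by a set of operators, as the double commutant of
`s ∪ s*`; `isLeast_generatedBy` shows that it is the smallest one containing `s`. -/
noncomputable def generatedBy (s : Set (H →L[ℂ] H)) : VonNeumannAlgebra H where
  toStarSubalgebra :=
    StarSubalgebra.centralizer ℂ (StarSubalgebra.centralizer ℂ s : Set (H →L[ℂ] H))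
  centralizer_centralizer' := by simp

theorem isLeast_generatedBy (s : Set (H →L[ℂ] H)) :
    IsLeast {N : VonNeumannAlgebra H | s ⊆ N} (generatedBy s) := by
  have hstar : star (Set.centralizer (s ∪ star s)) = Set.centralizer (s ∪ star s) := by
    rw [Set.star_centralizer, Set.union_star, star_star, Set.union_comm]
  have hcoe : (generatedBy s : Set (H →L[ℂ] H)) =
      Set.centralizer (Set.centralizer (s ∪ star s)) := by
    change ((StarSubalgebra.centralizer ℂ
      (StarSubalgebra.centralizer ℂ s : Set (H →L[ℂ] H)) : StarSubalgebra ℂ (H →L[ℂ] H)) :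
        Set (H →L[ℂ] H)) = _
    rw [StarSubalgebra.coe_centralizer, StarSubalgebra.coe_centralizer, hstar, Set.union_self]
  constructor
  · intro x hx
    rw [hcoe]
    exact Set.subset_centralizer_centralizer (Or.inl hx)
  · intro N hN x hx
    have hx' : x ∈ (generatedBy s : Set (H →L[ℂ] H)) := hx
    rw [hcoe] at hx'
    have hsub : s ∪ star s ⊆ (N : Set (H →L[ℂ] H)) := by
      rintro y (hy | hy)
      · exact hN hy
      · have : star (star y) ∈ N := star_mem (hN hy : star y ∈ N)
        simpa using this
    have := Set.centralizer_subset (Set.centralizer_subset hsub) hx'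
    rwa [N.centralizer_centralizer] at this

/-- The basic construction `⟨A, e_F⟩`: the smallest von Neumann algebra in `B(H)` containing
`A` and `e_F`. -/
noncomputable def basicConstruction (A F : VonNeumannAlgebra H) (Ω : H) : VonNeumannAlgebra H :=
  generatedBy ((A : Set (H →L[ℂ] H)) ∪ {F.cyclicProjection Ω})

end VonNeumannAlgebra

/-! For `a` in `F`, `j(a)` is right multiplication by `a` on `AΩ`, so it commutes with `A`, and with
`e_F` since `H_F` is itself a right-`F`-submodule. Hence it commutes with the basic construction,
and with `P_V` whenever `P_V` lies there; then `V` is invariant. Conversely, let `T` commute with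
`A` and `e_F`. Then `TΩ` lies in `H_F`, hence is a limit of vectors `fΩ` with `f` in `F`, and `T(aΩ)
= a(TΩ)` is a limit of `j(f)(aΩ)`. These `j(f)` need not converge as operators, but matrix
coefficients on `AΩ` suffice to pass from `P_V j(f) = j(f) P_V` to `P_V T = T P_V`. The double
commutant form of `⟨A, e_F⟩` concludes. -/

namespace VonNeumannAlgebra

variable {H : Type*} [NormedAddCommGroup H] [InnerProductSpace ℂ H] [CompleteSpace H]
  {A F : VonNeumannAlgebra H} {Ω : H}

/-- Continuous maps agreeing on `A Ω` are equal when `Ω` is cyclic. -/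
theorem IsTraceVector.eq_of_eqOn_orbit {Y : Type*} [TopologicalSpace Y] [T2Space Y]
    (h : A.IsTraceVector Ω) {f g : H → Y} (hf : Continuous f) (hg : Continuous g)
    (hfg : ∀ a ∈ A, f (a Ω) = g (a Ω)) : f = g :=
  h.cyclic.equalizer hf hg (funext fun a => hfg a a.2)

theorem IsTraceVector.modularConj_apply' (h : A.IsTraceVector Ω) {a : H →L[ℂ] H} (ha : a ∈ A) :
    A.modularConj Ω (a Ω) = (star a) Ω :=
  h.modularConj_apply ⟨a, ha⟩

theorem IsTraceVector.inner_comm (h : A.IsTraceVector Ω) {a b : H →L[ℂ] H} (ha : a ∈ A)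
    (hb : b ∈ A) : ⟪Ω, a (b Ω)⟫_ℂ = ⟪Ω, b (a Ω)⟫_ℂ :=
  h.trace ⟨a, ha⟩ ⟨b, hb⟩

/-- On `x = aΩ`, `y = bΩ` the two sides are `μ(ab)` and `μ(ba)`; density extends the identity one
variable at a time. -/
theorem IsTraceVector.inner_modularConj_left (h : A.IsTraceVector Ω) (x y : H) :
    ⟪A.modularConj Ω x, y⟫_ℂ = ⟪A.modularConj Ω y, x⟫_ℂ := by
  have key : ∀ a ∈ A, ∀ b ∈ A,
      ⟪A.modularConj Ω (a Ω), b Ω⟫_ℂ = ⟪A.modularConj Ω (b Ω), a Ω⟫_ℂ := by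
    intro a ha b hb
    rw [h.modularConj_apply' ha, h.modularConj_apply' hb, ContinuousLinearMap.star_eq_adjoint,
      ContinuousLinearMap.star_eq_adjoint, ContinuousLinearMap.adjoint_inner_left,
      ContinuousLinearMap.adjoint_inner_left, h.inner_comm ha hb]
  have key' : ∀ a ∈ A, ∀ y, ⟪A.modularConj Ω (a Ω), y⟫_ℂ = ⟪A.modularConj Ω y, a Ω⟫_ℂ :=
    fun a ha => congrFun (h.eq_of_eqOn_orbit (by fun_prop) (by fun_prop) (key a ha))
  exact congrFun (h.eq_of_eqOn_orbit (f := fun x => ⟪A.modularConj Ω x, y⟫_ℂ)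
    (g := fun x => ⟪A.modularConj Ω y, x⟫_ℂ) (by fun_prop) (by fun_prop)
    fun a ha => key' a ha y) x

theorem IsTraceVector.inner_modularConj_right (h : A.IsTraceVector Ω) (x y : H) :
    ⟪x, A.modularConj Ω y⟫_ℂ = ⟪y, A.modularConj Ω x⟫_ℂ := by
  rw [← inner_conj_symm, h.inner_modularConj_left, inner_conj_symm]

/-- Right multiplication: `(b Ω) a = b a Ω`. -/
theorem IsTraceVector.conjMap_apply (h : A.IsTraceVector Ω) {a b : H →L[ℂ] H} (ha : a ∈ A)
    (hb : b ∈ A) : A.conjMap Ω a (b Ω) = b (a Ω) := by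
  change A.modularConj Ω ((star a) (A.modularConj Ω (b Ω))) = _
  rw [h.modularConj_apply' hb]
  have := h.modularConj_apply' (mul_mem (star_mem ha) (star_mem hb))
  simpa using this

theorem IsTraceVector.star_conjMap (h : A.IsTraceVector Ω) (a : H →L[ℂ] H) :
    star (A.conjMap Ω a) = A.conjMap Ω (star a) := by
  rw [ContinuousLinearMap.star_eq_adjoint]
  refine ((ContinuousLinearMap.eq_adjoint_iff _ _).2 fun x y => ?_).symm
  change ⟪A.modularConj Ω ((star (star a)) (A.modularConj Ω x)), y⟫_ℂ =
    ⟪x, A.modularConj Ω ((star a) (A.modularConj Ω y))⟫_ℂ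
  rw [h.inner_modularConj_left, h.inner_modularConj_right, star_star,
    ContinuousLinearMap.star_eq_adjoint, ContinuousLinearMap.adjoint_inner_left]

/-- The right action of `A` commutes with the left action. -/
theorem IsTraceVector.mul_conjMap_comm (h : A.IsTraceVector Ω) {a c : H →L[ℂ] H} (ha : a ∈ A)
    (hc : c ∈ A) : c * A.conjMap Ω a = A.conjMap Ω a * c := by
  refine DFunLike.coe_injective (h.eq_of_eqOn_orbit (by fun_prop) (by fun_prop) fun b hb => ?_)
  have := h.conjMap_apply ha (mul_mem hc hb)
  simp only [_root_.mul_apply_eq_comp] at this ⊢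
  rw [this, h.conjMap_apply ha hb]

/-- For `T ∈ A'`, `T* Ω = J (T Ω)`. -/
theorem IsTraceVector.star_apply_of_mem_commutant (h : A.IsTraceVector Ω) {T : H →L[ℂ] H}
    (hT : T ∈ A.commutant) : (star T) Ω = A.modularConj Ω (T Ω) := by
  refine ext_inner_right ℂ fun v => congrFun (h.eq_of_eqOn_orbit
    (f := fun v => ⟪(star T) Ω, v⟫_ℂ) (g := fun v => ⟪A.modularConj Ω (T Ω), v⟫_ℂ)
    (by fun_prop) (by fun_prop) fun a ha => ?_) v
  have hcomm : a (T Ω) = T (a Ω) := DFunLike.congr_fun (mem_commutant_iff.1 hT a ha) Ω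
  rw [h.inner_modularConj_left, h.modularConj_apply' ha, ContinuousLinearMap.star_eq_adjoint,
    ContinuousLinearMap.star_eq_adjoint, ContinuousLinearMap.adjoint_inner_left,
    ContinuousLinearMap.adjoint_inner_left, hcomm]

theorem mem_cyclicSubspace_iff {x : H} :
    x ∈ F.cyclicSubspace Ω ↔ x ∈ closure (Set.range (F.orbitMap Ω)) := by
  rfl

theorem apply_mem_cyclicSubspace {a : H →L[ℂ] H} (ha : a ∈ F) : a Ω ∈ F.cyclicSubspace Ω :=
  mem_cyclicSubspace_iff.2 (subset_closure ⟨⟨a, ha⟩, rfl⟩)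

/-- `H_F` is a right-`F`-submodule. -/
theorem IsTraceVector.isRightSubmodule_cyclicSubspace (h : A.IsTraceVector Ω) (hF : F ≤ A) :
    A.IsRightSubmodule Ω F (F.cyclicSubspace Ω) := by
  intro x hx a ha
  rw [mem_cyclicSubspace_iff] at hx ⊢
  refine map_mem_closure (f := A.conjMap Ω a) (by fun_prop) hx ?_
  rintro _ ⟨f, rfl⟩
  exact ⟨⟨f * a, mul_mem f.2 ha⟩, (h.conjMap_apply (hF ha) (hF f.2)).symm⟩

/-- The projection onto a right-`F`-submodule commutes with the right action of `F`. -/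
theorem IsTraceVector.starProjection_comm_conjMap (h : A.IsTraceVector Ω)
    {V : ClosedSubmodule ℂ H} (hV : A.IsRightSubmodule Ω F V) {a : H →L[ℂ] H} (ha : a ∈ F) :
    V.toSubmodule.starProjection * A.conjMap Ω a =
      A.conjMap Ω a * V.toSubmodule.starProjection := by
  have inv : ∀ b ∈ F, V.toSubmodule.starProjection *
      (A.conjMap Ω b * V.toSubmodule.starProjection) =
        A.conjMap Ω b * V.toSubmodule.starProjection := fun b hb => by
    ext x
    exact Submodule.starProjection_eq_self_iff.2
      (hV _ (Submodule.starProjection_apply_mem _ x) b hb)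
  have hP : star V.toSubmodule.starProjection = V.toSubmodule.starProjection :=
    (isStarProjection_starProjection (U := V.toSubmodule)).isSelfAdjoint
  -- The adjoint of invariance under `j(a*)` is `P j(a) P = P j(a)`: the complement of `V` is
  -- invariant too.
  have hs := congrArg star (inv _ (star_mem ha))
  simp only [star_mul, hP, h.star_conjMap, star_star] at hs
  rw [← hs, mul_assoc, inv a ha]

theorem mem_generatedBy_iff {s : Set (H →L[ℂ] H)} {x : H →L[ℂ] H} :
    x ∈ generatedBy s ↔ ∀ z ∈ StarSubalgebra.centralizer ℂ s,
      z * x = x * z ∧ star z * x = x * star z :=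
  StarSubalgebra.mem_centralizer_iff ℂ

/-- The right action of `F` commutes with the basic construction. -/
theorem IsTraceVector.conjMap_mem_commutant_basicConstruction (h : A.IsTraceVector Ω)
    (hF : F ≤ A) {a : H →L[ℂ] H} (ha : a ∈ F) :
    A.conjMap Ω a ∈ (A.basicConstruction F Ω).commutant := by
  refine mem_commutant_iff.2 fun g hg => ?_
  refine ((mem_generatedBy_iff.1 hg _ ((StarSubalgebra.mem_centralizer_iff ℂ).2 ?_)).1).symm
  rintro c (hc | rfl)
  · exact ⟨h.mul_conjMap_comm (hF ha) hc, h.mul_conjMap_comm (hF ha) (star_mem hc)⟩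
  · have hs : star (F.cyclicProjection Ω) = F.cyclicProjection Ω :=
      (isStarProjection_starProjection (U := (F.cyclicSubspace Ω).toSubmodule)).isSelfAdjoint
    rw [hs, and_self]
    exact h.starProjection_comm_conjMap (h.isRightSubmodule_cyclicSubspace hF) ha

/-- An operator commuting with `A` and `e_F` commutes with the projection onto every
right-`F`-submodule. -/
theorem IsTraceVector.comm_starProjection_of_mem_commutant (h : A.IsTraceVector Ω) (hF : F ≤ A)
    {V : ClosedSubmodule ℂ H} (hV : A.IsRightSubmodule Ω F V) {T : H →L[ℂ] H}
    (hT : T ∈ A.commutant) (hTe : F.cyclicProjection Ω * T = T * F.cyclicProjection Ω) :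
    T * V.toSubmodule.starProjection = V.toSubmodule.starProjection * T := by
  set P := V.toSubmodule.starProjection
  -- Since `1 ∈ F`, `e_F` fixes `Ω`, so `e_F TΩ = T e_F Ω = TΩ`.
  have hTΩ : T Ω ∈ F.cyclicSubspace Ω := by
    have hΩ : F.cyclicProjection Ω Ω = Ω :=
      Submodule.starProjection_eq_self_iff.2 (apply_mem_cyclicSubspace (one_mem F))
    have hx : F.cyclicProjection Ω (T Ω) = T (F.cyclicProjection Ω Ω) :=
      DFunLike.congr_fun hTe Ω
    rw [hΩ] at hx
    exact Submodule.starProjection_eq_self_iff.1 hx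
  -- With `TΩ` replaced by a variable `ζ`, both sides are continuous in `ζ`, so `ζ = fΩ` with `f ∈
  -- F` suffices.
  have key : ∀ a ∈ A, ∀ b ∈ A,
      ⟪P (a Ω), b (A.modularConj Ω (T Ω))⟫_ℂ = ⟪P (a (T Ω)), b Ω⟫_ℂ := by
    intro a ha b hb
    refine Set.EqOn.closure (f := fun ζ => ⟪P (a Ω), b (A.modularConj Ω ζ)⟫_ℂ)
      (g := fun ζ => ⟪P (a ζ), b Ω⟫_ℂ) ?_ (by fun_prop) (by fun_prop)
      (mem_cyclicSubspace_iff.1 hTΩ)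
    rintro _ ⟨f, rfl⟩
    have hf : (f : H →L[ℂ] H) ∈ F := f.2
    change ⟪P (a Ω), b (A.modularConj Ω ((f : H →L[ℂ] H) Ω))⟫_ℂ =
      ⟪P (a ((f : H →L[ℂ] H) Ω)), b Ω⟫_ℂ
    -- Here `b f*Ω = j(f)* bΩ` and `a fΩ = j(f) aΩ`, which leaves `j(f) P = P j(f)`.
    rw [h.modularConj_apply' (hF hf), ← h.conjMap_apply (star_mem (hF hf)) hb, ← h.star_conjMap,
      ContinuousLinearMap.star_eq_adjoint, ContinuousLinearMap.adjoint_inner_right,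
      ← h.conjMap_apply (hF hf) ha]
    exact congrArg (⟪·, b Ω⟫_ℂ)
      (DFunLike.congr_fun (h.starProjection_comm_conjMap hV hf) (a Ω)).symm
  refine DFunLike.coe_injective (h.eq_of_eqOn_orbit (by fun_prop) (by fun_prop) fun a ha => ?_)
  refine ext_inner_right ℂ fun v => congrFun (h.eq_of_eqOn_orbit
    (f := fun v => ⟪(T * P) (a Ω), v⟫_ℂ) (g := fun v => ⟪(P * T) (a Ω), v⟫_ℂ)
    (by fun_prop) (by fun_prop) fun b hb => ?_) v
  have hTa : a (T Ω) = T (a Ω) := DFunLike.congr_fun (mem_commutant_iff.1 hT a ha) Ω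
  have hTb : b ((star T) Ω) = (star T) (b Ω) :=
    DFunLike.congr_fun (mem_commutant_iff.1 (star_mem hT) b hb) Ω
  have := key a ha b hb
  -- As `J TΩ = T*Ω` and `T`, `T*` commute with `A`, `key` reads `⟪P aΩ, T* bΩ⟫ = ⟪P T aΩ, bΩ⟫`.
  rw [← h.star_apply_of_mem_commutant hT, hTb, hTa, ContinuousLinearMap.star_eq_adjoint,
    ContinuousLinearMap.adjoint_inner_right] at this
  exact this

end VonNeumannAlgebra

open VonNeumannAlgebra in
theorem mainTheorem11 {H : Type*} [NormedAddCommGroup H] [InnerProductSpace ℂ H]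
    [CompleteSpace H] (A F : VonNeumannAlgebra H) (Ω : H)
    (hΩ : A.IsTraceVector Ω) (hF : F ≤ A) (V : ClosedSubmodule ℂ H) :
    A.IsRightSubmodule Ω F V ↔
      V.toSubmodule.starProjection ∈ A.basicConstruction F Ω := by
  constructor
  · intro hV
    have comm : ∀ z ∈ StarSubalgebra.centralizer ℂ
        ((A : Set (H →L[ℂ] H)) ∪ {F.cyclicProjection Ω}),
        z * V.toSubmodule.starProjection = V.toSubmodule.starProjection * z := fun z hz => by
      rw [StarSubalgebra.mem_centralizer_iff] at hz
      exact hΩ.comm_starProjection_of_mem_commutant hF hV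
        (mem_commutant_iff.2 fun g hg => (hz g (Or.inl hg)).1) (hz _ (Or.inr rfl)).1
    exact mem_generatedBy_iff.2 fun z hz => ⟨comm z hz, comm _ (star_mem hz)⟩
  · intro hP x hx a ha
    have hcomm := DFunLike.congr_fun (mem_commutant_iff.1
      (hΩ.conjMap_mem_commutant_basicConstruction hF ha) _ hP) x
    have hPx : V.toSubmodule.starProjection x = x := Submodule.starProjection_eq_self_iff.2 hx
    refine Submodule.starProjection_eq_self_iff.1 (hcomm.trans ?_)
    exact congrArg (A.conjMap Ω a) hPx
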